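/- Write $a\vee b=\max\{a,b\}$; on $[0,1]^T$ ($T$ any set, product topology) $\vee$ and multiplication by $\lambda\in[0,1]$ are taken coordinatewise. A max-$\cdot$ convex compactum is a compact subset $X\subseteq[0,1]^T$ such that $\lambda\cdot a\vee b\in X$ for all $a,b\in X$ and $\lambda\in[0,1]$. For a compact Hausdorff space $X$, a $\cdot$-measure on $X$ is a functional $\mu:C(X,[0,1])\to[0,1]$ such that $\mu(1_X)=1$, $\mu(\lambda_X\cdot\varphi)=\lambda\cdot\mu(\varphi)$ and $\mu(\psi\vee\varphi)=\mu(\psi)\vee\mu(\varphi)$ for all $\lambda\in[0,1]$ and $\varphi,\psi\in C(X,[0,1])$, where $\lambda_X$ is the constant function with value $\lambda$. Let $A^\cdot X$ be the set of all $\cdot$-measures on $X$ with the topology of a subspace of $[0,1]^{C(X,[0,1])}$ (product topology), and let $A^\cdot_\omega X\subseteq A^\cdot X$ be the subspace of all functionals $\bigvee_{i=1}^n\lambda_i\cdot\delta_{x_i}:\varphi\mapsto\max_{1\le i\le n}\lambda_i\varphi(x_i)$ with $n\ge 1$, $x_1,\dots,x_n\in X$, $\lambda_1,\dots,\lambda_n\in[0,1]$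 and $\bigvee_{i=1}^n\lambda_i=1$. For a max-$\cdot$ convex compactum $X\subseteq[0,1]^T$ the max-$\cdot$ barycenter map $\beta^\cdot_X:A^\cdot X\to X$ is defined by $\mathrm{pr}_t(\beta^\cdot_X(\mu))=\mu(\mathrm{pr}_t|_X)$ for all $t\in T$ (this point always belongs to $X$). Put $J=\{(t,p)\in[0,1]\times[0,1]\mid t\vee p=1\}$ and let $s_X:X\times X\times J\to X$ be the map $s_X(x,y,t,p)=t\cdot x\vee p\cdot y$. **Theorem.** Let $X$ be a max-$\cdot$ convex compactum. Then the following statements are equivalent: 1. the map $\beta^\cdot_X|_{A^\cdot_\omega X}:A^\cdot_\omega X\to X$ is open; 2. the map $\beta^\cdot_X:A^\cdot X\to X$ is open; 3. the map $s_X:X\times X\times J\to X$ is open. -/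

import Mathlib

open Set Topology unitInterval

/-- A functional `μ : C(X,[0,1]) → [0,1]` is a `·`-measure if it is normed, homogeneous with
respect to multiplication by constants of `[0,1]`, and preserves pointwise maxima. -/
structure IsDotMeasure {X : Type*} [TopologicalSpace X] (μ : C(X, I) → I) : Prop where
  map_one : μ (ContinuousMap.const X 1) = 1
  map_const_mul : ∀ (c : I) (φ : C(X, I)), μ (ContinuousMap.const X c * φ) = c * μ φ
  map_sup : ∀ ψ φ : C(X, I), μ (ψ ⊔ φ) = μ ψ ⊔ μ φ

/-- The space `A^·(X)` of all `·`-measures. As a type it carries the subspace topology of the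
product `[0,1]^{C(X,[0,1])}`. -/
def dotMeasures (X : Type*) [TopologicalSpace X] : Set (C(X, I) → I) :=
  {μ | IsDotMeasure μ}

/-- The set `A^·_ω(X)` of the `·`-measures `⋁ᵢ λᵢ · δ_{xᵢ}` (a finite maximum), where
`⋁ᵢ λᵢ = 1` and `δ_x(φ) = φ(x)`. -/
def finDotMeasures (X : Type*) [TopologicalSpace X] : Set (dotMeasures X) :=
  {μ | ∃ (n : ℕ) (x : Fin n → X) (c : Fin n → I), Finset.univ.sup c = 1 ∧
    ∀ φ : C(X, I), μ.1 φ = Finset.univ.sup fun i => c i * φ (x i)}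

/-- Max-`·` convex subsets of `[0,1]^T`. -/
def IsMaxDotConvex {T : Type*} (K : Set (T → I)) : Prop :=
  ∀ a ∈ K, ∀ b ∈ K, ∀ c : I, (fun t => c * a t ⊔ b t) ∈ K

/-- The restriction to `K` of the projection `[0,1]^T → [0,1]` onto the coordinate `t`. -/
def coordMap {T : Type*} (K : Set (T → I)) (t : T) : C(K, I) :=
  ⟨fun x => x.1 t, (continuous_apply t).comp continuous_subtype_val⟩

namespace IsDotMeasure

theorem mono {X : Type*} [TopologicalSpace X] {μ : C(X, I) → I} (h : IsDotMeasure μ)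
    {φ ψ : C(X, I)} (hle : ∀ x, φ x ≤ ψ x) : μ φ ≤ μ ψ := by
  have e : φ ⊔ ψ = ψ := sup_eq_right.2 (ContinuousMap.le_def.2 hle)
  have := h.map_sup φ ψ
  rw [e] at this
  rw [this]
  exact le_sup_left

theorem map_const {X : Type*} [TopologicalSpace X] {μ : C(X, I) → I} (h : IsDotMeasure μ)
    (c : I) : μ (ContinuousMap.const X c) = c := by
  have := h.map_const_mul c (ContinuousMap.const X 1)
  rw [h.map_one, mul_one] at this
  have e : ContinuousMap.const X c * ContinuousMap.const X 1 = ContinuousMap.const X c := by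
    ext x
    simp
  rwa [e] at this

theorem exists_point {T : Type*} {K : Set (T → I)} (hK : IsCompact K) {μ : C(K, I) → I}
    (h : IsDotMeasure μ) (f : C(K, I)) (s : I) (hs : s < μ f) :
    ∃ x : K, s ≤ f x ∧ ∀ u, s * x.1 u ≤ μ (coordMap K u) * f x := by
  by_contra! hcon
  have : CompactSpace K := isCompact_iff_compactSpace.1 hK
  have hA : IsCompact {x : K | s ≤ f x} :=
    (isClosed_le continuous_const f.continuous).isCompact
  have key : ∃ g : C(K, I), μ g ≤ s ∧ ∀ y ∈ {x : K | s ≤ f x}, f y ≤ g y := by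
    refine hA.induction_on (p := fun A => ∃ g : C(K, I), μ g ≤ s ∧ ∀ y ∈ A, f y ≤ g y)
      ⟨ContinuousMap.const K 0, ?_, ?_⟩ ?_ ?_ ?_
    · rw [h.map_const]; exact unitInterval.nonneg'
    · intro y hy; exact hy.elim
    · rintro A B hAB ⟨g, hg, hg'⟩
      exact ⟨g, hg, fun y hy => hg' y (hAB hy)⟩
    · rintro A B ⟨g, hg, hg'⟩ ⟨k, hk, hk'⟩
      refine ⟨g ⊔ k, ?_, ?_⟩
      · rw [h.map_sup]; exact sup_le hg hk
      · rintro y (hy | hy)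
        · exact (hg' y hy).trans le_sup_left
        · exact (hk' y hy).trans le_sup_right
    · intro x hx
      obtain ⟨u, hu⟩ := hcon x hx
      have hu' : (μ (coordMap K u) : ℝ) * f x < s * x.1 u := by exact_mod_cast hu
      have hx' : (s : ℝ) ≤ f x := by exact_mod_cast hx
      have h0 : (0 : ℝ) ≤ s := s.2.1
      have hb0 : (0 : ℝ) ≤ μ (coordMap K u) := (μ (coordMap K u)).2.1
      have hxu1 : (x.1 u : ℝ) ≤ 1 := (x.1 u).2.2
      have hxu0 : (0 : ℝ) ≤ x.1 u := (x.1 u).2.1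
      have hf0 : (0 : ℝ) < f x := by
        rcases (h0.trans hx').lt_or_eq with h1 | h1
        · exact h1
        · exfalso
          have : (s : ℝ) = 0 := le_antisymm (h1 ▸ hx') h0
          rw [this] at hu'
          nlinarith
      obtain ⟨r, hr1, hr2⟩ := exists_between ((lt_div_iff₀ hf0).2 hu')
      have hr0 : 0 < r := hb0.trans_lt hr1
      rw [lt_div_iff₀ hf0] at hr2
      have hrle : r ≤ 1 := by
        by_contra! h1
        nlinarith
      let g : C(K, I) := ⟨fun y => Set.projIcc 0 1 zero_le_one ((s : ℝ) * y.1 u / r),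
        continuous_projIcc.comp (((continuous_const.mul (continuous_subtype_val.comp
          ((continuous_apply u).comp continuous_subtype_val))).div_const r))⟩
      have hgv : ∀ y, (g y : ℝ) = max 0 (min 1 ((s : ℝ) * y.1 u / r)) := fun y => rfl
      refine ⟨{y : K | r * f y < s * y.1 u}, ?_, g, ?_, ?_⟩
      · refine mem_nhdsWithin_of_mem_nhds (IsOpen.mem_nhds (isOpen_lt ?_ ?_) hr2)
        · exact continuous_const.mul (continuous_subtype_val.comp f.continuous)
        · exact continuous_const.mul (continuous_subtype_val.comp
            ((continuous_apply u).comp continuous_subtype_val))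
      · have hle : μ (ContinuousMap.const K ⟨r, hr0.le, hrle⟩ * g) ≤
            μ (ContinuousMap.const K s * coordMap K u) := by
          refine h.mono fun y => ?_
          change (r : ℝ) * (g y : ℝ) ≤ (s : ℝ) * (y.1 u : ℝ)
          rw [hgv]
          have hn : (0 : ℝ) ≤ s * y.1 u := mul_nonneg h0 (y.1 u).2.1
          have : max 0 (min 1 ((s : ℝ) * y.1 u / r)) ≤ (s : ℝ) * y.1 u / r :=
            max_le (by positivity) (min_le_right _ _)
          calc r * _ ≤ r * ((s : ℝ) * y.1 u / r) := by gcongr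
            _ = _ := by field_simp
        rw [h.map_const_mul, h.map_const_mul] at hle
        have hle' : r * (μ g : ℝ) ≤ (s : ℝ) * μ (coordMap K u) := hle
        have : (μ g : ℝ) ≤ s := by
          by_contra! h1
          nlinarith
        exact this
      · intro y hy
        have hy' : r * (f y : ℝ) < s * y.1 u := hy
        change (f y : ℝ) ≤ (g y : ℝ)
        rw [hgv]
        refine le_max_of_le_right (le_min (f y).2.2 ?_)
        rw [le_div_iff₀ hr0]
        linarith
  obtain ⟨g, hg, hg'⟩ := key
  have : μ f ≤ μ (g ⊔ ContinuousMap.const K s) := by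
    refine h.mono fun y => ?_
    rcases le_total s (f y) with h1 | h1
    · exact (hg' y h1).trans le_sup_left
    · exact h1.trans le_sup_right
  rw [h.map_sup, h.map_const] at this
  exact absurd (this.trans (sup_le hg le_rfl)) (not_le.2 hs)

/-- The barycenter of a `·`-measure on a max-`·` convex compactum `K` belongs to `K`. -/
theorem barycenter_mem {T : Type*} {K : Set (T → I)} (hK : IsCompact K)
    (hconv : IsMaxDotConvex K) {μ : C(K, I) → I} (h : IsDotMeasure μ) :
    (fun t => μ (coordMap K t)) ∈ K := by
  set b : T → I := fun t => μ (coordMap K t) with hb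
  have approx : ∀ ε : ℝ, 0 < ε → ε < 1 → ∀ F : Finset T,
      ∃ z ∈ K, (∀ u, (z u : ℝ) ≤ b u + ε) ∧ ∀ t ∈ F, (b t : ℝ) - ε ≤ z t := by
    classical
    intro ε h0 h1 F
    induction F using Finset.induction_on with
    | empty =>
      obtain ⟨x, -, hx⟩ := h.exists_point hK (ContinuousMap.const K 1)
        ⟨1 - ε, by linarith, by linarith⟩ (by
          rw [h.map_one]
          change (1 - ε : ℝ) < 1
          linarith)
      refine ⟨x.1, x.2, fun u => ?_, by simp⟩
      have h2 : (1 - ε) * (x.1 u : ℝ) ≤ (b u : ℝ) * 1 := hx u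
      have h3 : (x.1 u : ℝ) ≤ 1 := (x.1 u).2.2
      nlinarith
    | insert t F _ ih =>
      obtain ⟨z, hz, hz1, hz2⟩ := ih
      rcases le_or_gt ((b t : ℝ) - ε) 0 with hs | hs
      · refine ⟨z, hz, hz1, fun i hi => ?_⟩
        rcases Finset.mem_insert.1 hi with rfl | hi
        · exact hs.trans (z i).2.1
        · exact hz2 i hi
      · obtain ⟨x, hx1, hx2⟩ := h.exists_point hK (coordMap K t)
          ⟨(b t : ℝ) - ε, hs.le, by linarith [(b t).2.2]⟩ (by
            change (b t : ℝ) - ε < b t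
            linarith)
        have hx1' : (b t : ℝ) - ε ≤ x.1 t := hx1
        have hx0 : (0 : ℝ) < x.1 t := hs.trans_le hx1'
        refine ⟨_, hconv x.1 x.2 z hz
          ⟨((b t : ℝ) - ε) / x.1 t, by positivity, (div_le_one hx0).2 hx1'⟩, ?_, ?_⟩
        · intro u
          have h2 : ((b t : ℝ) - ε) * (x.1 u : ℝ) ≤ (b u : ℝ) * x.1 t := hx2 u
          have h3 : ((b t : ℝ) - ε) / x.1 t * (x.1 u : ℝ) ≤ b u := by
            rw [div_mul_eq_mul_div, div_le_iff₀ hx0]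
            exact h2
          have h4 := hz1 u
          rw [show ∀ p q : I, ((p ⊔ q : I) : ℝ) = max (p : ℝ) q from
            fun p q => (Subtype.mono_coe _).map_sup p q]
          exact max_le (by
            change ((b t : ℝ) - ε) / x.1 t * (x.1 u : ℝ) ≤ _
            linarith) h4
        · intro i hi
          rw [show ∀ p q : I, ((p ⊔ q : I) : ℝ) = max (p : ℝ) q from
            fun p q => (Subtype.mono_coe _).map_sup p q]
          rcases Finset.mem_insert.1 hi with rfl | hi
          · refine le_max_of_le_left ?_
            change _ ≤ ((b i : ℝ) - ε) / x.1 i * (x.1 i : ℝ)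
            rw [div_mul_cancel₀ _ hx0.ne']
          · exact le_max_of_le_right (hz2 i hi)
  by_contra hbK
  obtain ⟨F, u, hu, hsub⟩ := isOpen_pi_iff.1 hK.isClosed.isOpen_compl b hbK
  have hev : ∀ᶠ ε in 𝓝[>] (0 : ℝ), (∀ i ∈ F, Metric.closedBall (b i) ε ⊆ u i) ∧ 0 < ε ∧ ε < 1 := by
    refine Filter.Eventually.and ?_ (Ioo_mem_nhdsGT one_pos)
    rw [Filter.eventually_all_finset]
    intro i hi
    obtain ⟨δ, hδ, hball⟩ := Metric.isOpen_iff.1 (hu i hi).1 _ (hu i hi).2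
    filter_upwards [Ioo_mem_nhdsGT hδ] with ε hε
    exact (Metric.closedBall_subset_ball hε.2).trans hball
  obtain ⟨ε, hε, h0, h1⟩ := hev.exists
  obtain ⟨z, hz, hz1, hz2⟩ := approx ε h0 h1 F
  refine hsub (fun i hi => hε i hi ?_) hz
  rw [Metric.mem_closedBall, Subtype.dist_eq, Real.dist_eq, abs_le]
  have := hz1 i
  have := hz2 i hi
  constructor <;> linarith

end IsDotMeasure

/-- The max-`·` barycenter map `β^·_K : A^·(K) → K` of a max-`·` convex compactum `K`; its
coordinate `t` at `μ` is the value of `μ` on the coordinate function `pr_t|_K`. -/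
def dotBarycenter {T : Type*} (K : Set (T → I)) (hK : IsCompact K) (hconv : IsMaxDotConvex K) :
    dotMeasures K → K :=
  fun μ => ⟨fun t => μ.1 (coordMap K t), IsDotMeasure.barycenter_mem hK hconv μ.2⟩

/-- `J = {(t,p) ∈ [0,1] × [0,1] | t ∨ p = 1}`. -/
def dotJ : Set (I × I) := {q | q.1 ⊔ q.2 = 1}

theorem IsMaxDotConvex.comb_mem {T : Type*} {K : Set (T → I)} (hconv : IsMaxDotConvex K)
    (x y : K) (q : dotJ) : (fun i => q.1.1 * x.1 i ⊔ q.1.2 * y.1 i) ∈ K := by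
  obtain ⟨⟨t, p⟩, hq⟩ := q
  change t ⊔ p = 1 at hq
  rcases le_total t p with h | h
  · rw [sup_eq_right.2 h] at hq
    subst hq
    simpa using hconv x.1 x.2 y.1 y.2 t
  · rw [sup_eq_left.2 h] at hq
    subst hq
    simpa [sup_comm] using hconv y.1 y.2 x.1 x.2 p

/-- The map of max-`·` convex combination `s_K : K × K × J → K`,
`s_K(x,y,t,p) = t · x ∨ p · y`. -/
def dotComb {T : Type*} (K : Set (T → I)) (hconv : IsMaxDotConvex K) : K × K × dotJ → K :=
  fun w => ⟨fun i => w.2.2.1.1 * w.1.1 i ⊔ w.2.2.1.2 * w.2.1.1 i,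
    hconv.comb_mem w.1 w.2.1 w.2.2⟩

/-! Functions with pointwise maximum `1` act as a partition of unity for `∨`. If `f₁ ∨ … ∨ fₙ = 1`,
then `μ(φ) = ⋁ μ(fᵢφ)`, and every nonzero piece, divided by `μ(fᵢ)`, is again a measure with a
barycenter `bᵢ`. A coordinate slab containing the support of `fᵢ` also contains `bᵢ`.

Replacing each piece by `μ(fᵢ)·δ_{bᵢ}`, for `fᵢ` of small support, gives a finite measure close to
`μ` with exactly the same barycenter (`exists_finDotMeasure_same_barycenter`). Hence an open set and
its finite part have the same image, so 1 ⇔ 2, and openness of the barycenter map need only be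
tested at finite measures.

For 3 ⇒ 2, local openness holds at Dirac measures, where `x ↦ δ_x` is a continuous section, and
passes to `t·μ ∨ p·δ_y` because the barycenter map turns this combination into `s`.

For 2 ⇒ 3, one coefficient is `1`, say the first, and the points may be assumed distinct. A pair `f
∨ g = 1` separating `x` from `y` splits each `μ` near `δ_x ∨ p·δ_y`, so that its barycenter is `s(u,
v, μ(f), μ(g))` with arguments close to `(x, y, 1, p)`. -/

/-! ### Maxima in the unit interval and separating functions -/

theorem unitInterval.coe_sup (p q : I) : ((p ⊔ q : I) : ℝ) = max (p : ℝ) q :=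
  (Subtype.mono_coe _).map_sup p q

theorem unitInterval.mul_sup (a b c : I) : a * (b ⊔ c) = a * b ⊔ a * c :=
  (show Monotone fun x : I => a * x from fun _ _ h => mul_le_mul_right h a).map_sup b c

theorem unitInterval.finset_sup_le_add {ι : Type*} (S : Finset ι) (a b : ι → I) {ε : ℝ}
    (hε : 0 ≤ ε) (h : ∀ i ∈ S, (a i : ℝ) ≤ b i + ε) :
    ((S.sup a : I) : ℝ) ≤ (S.sup b : I) + ε := by
  rcases S.eq_empty_or_nonempty with rfl | hS
  · simpa using hε
  · obtain ⟨i, hi, he⟩ := Finset.exists_mem_eq_sup S hS a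
    rw [he]
    have : (b i : ℝ) ≤ (S.sup b : I) := Finset.le_sup (f := b) hi
    linarith [h i hi]

/-- A pair of functions with maximum `1`, the second supported in a given neighbourhood `O` of a
point and the first vanishing at that point. -/
theorem exists_sup_eq_one {X : Type*} [TopologicalSpace X] [CompactSpace X] [T2Space X]
    {y : X} {O : Set X} (hO : O ∈ 𝓝 y) :
    ∃ f g : C(X, I), f ⊔ g = ContinuousMap.const X 1 ∧ f y = 0 ∧ ∀ z ∉ O, g z = 0 := by
  obtain ⟨k, hk0, hk1, hk⟩ := exists_continuous_zero_one_of_isClosed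
    (isOpen_interior (s := O)).isClosed_compl (isClosed_singleton (x := y))
    (by
      rw [disjoint_singleton_right]
      exact fun h => h (mem_interior_iff_mem_nhds.2 hO))
  -- At each point `k ≤ 1/2` or `k ≥ 1/2`, so after doubling and truncating, one of the two
  -- functions equals `1`.
  refine ⟨⟨fun z => projIcc 0 1 zero_le_one (2 * (1 - k z)),
      continuous_projIcc.comp (by fun_prop)⟩,
    ⟨fun z => projIcc 0 1 zero_le_one (2 * k z), continuous_projIcc.comp (by fun_prop)⟩,
    ?_, ?_, ?_⟩
  · ext z
    change ((projIcc (0 : ℝ) 1 zero_le_one (2 * (1 - k z)) ⊔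
      projIcc 0 1 zero_le_one (2 * k z) : I) : ℝ) = 1
    rw [unitInterval.coe_sup]
    rcases le_total (k z) (1 / 2) with h | h
    · rw [projIcc_of_right_le _ (show (1 : ℝ) ≤ 2 * (1 - k z) by linarith)]
      exact max_eq_left (projIcc (0 : ℝ) 1 zero_le_one (2 * k z)).2.2
    · rw [projIcc_of_right_le _ (show (1 : ℝ) ≤ 2 * k z by linarith)]
      exact max_eq_right (projIcc (0 : ℝ) 1 zero_le_one (2 * (1 - k z))).2.2
  · change projIcc (0 : ℝ) 1 zero_le_one (2 * (1 - k y)) = 0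
    rw [hk1 rfl]
    exact projIcc_of_le_left _ (by simp)
  · intro z hz
    change projIcc (0 : ℝ) 1 zero_le_one (2 * k z) = 0
    rw [hk0 (fun h => hz (interior_subset h))]
    exact projIcc_of_le_left _ (by simp)

/-! ### Restriction of measures and barycenters of the pieces -/

namespace IsDotMeasure

section

variable {X : Type*} [TopologicalSpace X] {μ : C(X, I) → I}

theorem exists_finset_sup (h : IsDotMeasure μ) {ι : Type*} (S : Finset ι) (f : ι → C(X, I)) :
    ∃ g : C(X, I), (∀ z, g z = S.sup fun i => f i z) ∧ μ g = S.sup fun i => μ (f i) := by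
  classical
  induction S using Finset.induction_on with
  | empty => exact ⟨ContinuousMap.const X 0, fun _ => rfl, h.map_const 0⟩
  | insert i S _ ih =>
    obtain ⟨g, hg, hg'⟩ := ih
    refine ⟨f i ⊔ g, fun z => ?_, ?_⟩
    · rw [Finset.sup_insert, ← hg]
      rfl
    · rw [Finset.sup_insert, h.map_sup, hg']

/-- Localisation: where `f` lives, `φ` may be replaced by a constant near its values. -/
theorem abs_map_mul_sub_le (h : IsDotMeasure μ) (f φ : C(X, I)) (a : I) (ε : ℝ)
    (hφ : ∀ z, f z ≠ 0 → |(φ z : ℝ) - a| ≤ ε) (hε : 0 ≤ ε) :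
    |(μ (f * φ) : ℝ) - μ f * a| ≤ μ f * ε := by
  have h0 : (0 : ℝ) ≤ μ f := (μ f).2.1
  have ha0 : (0 : ℝ) ≤ a := a.2.1
  have ha1 : (a : ℝ) ≤ 1 := a.2.2
  have up : μ (f * φ) ≤ μ (ContinuousMap.const X
      ⟨min 1 (a + ε), le_min zero_le_one (by linarith), min_le_left _ _⟩ * f) := by
    refine h.mono fun z => ?_
    change (f z : ℝ) * φ z ≤ min 1 ((a : ℝ) + ε) * f z
    by_cases hz : f z = 0
    · simp [hz]
    · rw [mul_comm]
      exact mul_le_mul_of_nonneg_right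
        (le_min (φ z).2.2 (by linarith [(abs_le.1 (hφ z hz)).2])) (f z).2.1
  have lo : μ (ContinuousMap.const X
      ⟨max 0 (a - ε), le_max_left _ _, max_le zero_le_one (by linarith)⟩ * f) ≤ μ (f * φ) := by
    refine h.mono fun z => ?_
    change max 0 ((a : ℝ) - ε) * f z ≤ (f z : ℝ) * φ z
    by_cases hz : f z = 0
    · simp [hz]
    · rw [mul_comm (f z : ℝ)]
      exact mul_le_mul_of_nonneg_right
        (max_le (φ z).2.1 (by linarith [(abs_le.1 (hφ z hz)).1])) (f z).2.1
  rw [h.map_const_mul] at up lo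
  have up' : (μ (f * φ) : ℝ) ≤ min 1 ((a : ℝ) + ε) * μ f := up
  have lo' : max 0 ((a : ℝ) - ε) * μ f ≤ (μ (f * φ) : ℝ) := lo
  have h1 := mul_le_mul_of_nonneg_right (min_le_right 1 ((a : ℝ) + ε)) h0
  have h2 := mul_le_mul_of_nonneg_right (le_max_right 0 ((a : ℝ) - ε)) h0
  rw [abs_le]
  constructor <;> linarith

/-- The normalised restriction `φ ↦ μ (f * φ) / μ f`. -/
theorem exists_restrict (h : IsDotMeasure μ) (f : C(X, I)) (hf : μ f ≠ 0) :
    ∃ ν : C(X, I) → I, IsDotMeasure ν ∧ ∀ φ, μ f * ν φ = μ (f * φ) := by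
  have hpos : (0 : ℝ) < μ f := unitInterval.pos_iff_ne_zero.2 hf
  have hle : ∀ φ, μ (f * φ) ≤ μ f := fun φ => h.mono fun z => mul_le_of_le_one_right' le_one'
  -- The axioms for `ν` are checked after multiplication by `μ f`, which cancels.
  have inj : ∀ a b : I, μ f * a = μ f * b → a = b := fun a b hab =>
    Subtype.ext (mul_left_cancel₀ hpos.ne' (congrArg Subtype.val hab))
  let ν : C(X, I) → I := fun φ =>
    ⟨μ (f * φ) / μ f, div_nonneg (μ (f * φ)).2.1 hpos.le, (div_le_one hpos).2 (hle φ)⟩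
  have hν : ∀ φ, μ f * ν φ = μ (f * φ) := fun φ => Subtype.ext (mul_div_cancel₀ _ hpos.ne')
  refine ⟨ν, ⟨?_, fun c φ => ?_, fun φ ψ => ?_⟩, hν⟩
  · apply inj
    rw [hν, mul_one]
    congr 1
    ext z
    simp
  · apply inj
    rw [hν, mul_left_comm f, h.map_const_mul, mul_left_comm (μ f), hν]
  · apply inj
    rw [hν, unitInterval.mul_sup, hν, hν, ← h.map_sup]
    congr 1
    ext z
    exact congrArg Subtype.val (unitInterval.mul_sup (f z) (φ z) (ψ z))

end

/-- The barycenter of the restriction of `μ` to `f`, taken to be a prescribed point `y` if the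
restriction is zero. It lies in every coordinate slab that contains `y` and the support of `f`. -/
theorem exists_restrict_barycenter {T : Type*} {K : Set (T → I)} (hK : IsCompact K)
    (hconv : IsMaxDotConvex K) {μ : C(K, I) → I} (h : IsDotMeasure μ) (f : C(K, I)) (y : K) :
    ∃ b : K, (∀ t, μ f * b.1 t = μ (f * coordMap K t)) ∧
      ∀ (t : T) (a : I) (ε : ℝ), (∀ z : K, f z ≠ 0 → |(z.1 t : ℝ) - a| ≤ ε) →
        |(y.1 t : ℝ) - a| ≤ ε → |(b.1 t : ℝ) - a| ≤ ε := by
  by_cases hf : μ f = 0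
  -- When `μ f = 0`, monotonicity makes both sides of the equation zero, so any point serves; `y`
  -- also satisfies the slab condition.
  · refine ⟨y, fun t => ?_, fun _ _ _ _ hy => hy⟩
    rw [hf, zero_mul]
    refine (le_antisymm ?_ unitInterval.nonneg').symm
    rw [← hf]
    exact h.mono fun z => mul_le_of_le_one_right' le_one'
  · obtain ⟨ν, hν, hνf⟩ := h.exists_restrict f hf
    refine ⟨⟨_, hν.barycenter_mem hK hconv⟩, fun t => hνf _, fun t a ε hz hy => ?_⟩
    have hpos : (0 : ℝ) < μ f := unitInterval.pos_iff_ne_zero.2 hf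
    have := h.abs_map_mul_sub_le f (coordMap K t) a ε hz ((abs_nonneg _).trans hy)
    rw [← hνf] at this
    change |(μ f : ℝ) * ν (coordMap K t) - μ f * a| ≤ μ f * ε at this
    rw [← mul_sub, abs_mul, abs_of_pos hpos] at this
    exact le_of_mul_le_mul_left this hpos

end IsDotMeasure

/-! ### Dirac measures and their combinations -/

section

variable {X : Type*} [TopologicalSpace X]

theorem isDotMeasure_eval (x : X) : IsDotMeasure fun φ : C(X, I) => φ x :=
  ⟨rfl, fun _ _ => rfl, fun _ _ => rfl⟩

theorem IsDotMeasure.comb {μ ν : C(X, I) → I} (hμ : IsDotMeasure μ) (hν : IsDotMeasure ν)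
    (q : dotJ) : IsDotMeasure fun φ => q.1.1 * μ φ ⊔ q.1.2 * ν φ := by
  refine ⟨?_, fun c φ => ?_, fun φ ψ => ?_⟩
  · rw [hμ.map_one, hν.map_one, mul_one, mul_one]
    exact q.2
  · simp only [hμ.map_const_mul, hν.map_const_mul, unitInterval.mul_sup, mul_left_comm c]
  · simp only [hμ.map_sup, hν.map_sup, unitInterval.mul_sup]
    exact sup_sup_sup_comm _ _ _ _

/-- The Dirac measure. -/
def dotDirac (x : X) : dotMeasures X := ⟨fun φ => φ x, isDotMeasure_eval x⟩

/-- The max-`·` convex combination `t · μ ∨ p · ν` of `·`-measures. -/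
def dotMeasureComb (μ ν : dotMeasures X) (q : dotJ) : dotMeasures X :=
  ⟨_, μ.2.comb ν.2 q⟩

theorem continuous_dotMeasure_apply (φ : C(X, I)) : Continuous fun μ : dotMeasures X => μ.1 φ :=
  (continuous_apply φ).comp continuous_subtype_val

theorem continuous_dotMeasureComb_dirac :
    Continuous fun w : dotMeasures X × X × dotJ => dotMeasureComb w.1 (dotDirac w.2.1) w.2.2 := by
  refine Continuous.subtype_mk (continuous_pi fun φ => ?_) _
  refine Continuous.sup (Continuous.mul ?_ ?_) (Continuous.mul ?_ ?_)
  · exact continuous_fst.comp (continuous_subtype_val.comp (continuous_snd.comp continuous_snd))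
  · exact (continuous_dotMeasure_apply φ).comp continuous_fst
  · exact continuous_snd.comp (continuous_subtype_val.comp (continuous_snd.comp continuous_snd))
  · exact φ.continuous.comp (continuous_fst.comp continuous_snd)

/-- A finite combination of Dirac measures over an arbitrary finite index set. -/
theorem mem_finDotMeasures_of_finset {ι : Type*} (S : Finset ι) (x : ι → X) (c : ι → I)
    (hc : S.sup c = 1) (μ : dotMeasures X) (hμ : ∀ φ, μ.1 φ = S.sup fun i => c i * φ (x i)) :
    μ ∈ finDotMeasures X := by
  have key : ∀ f : ι → I, (Finset.univ.sup fun j => f (S.equivFin.symm j)) = S.sup f := by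
    intro f
    apply le_antisymm
    · exact Finset.sup_le fun j _ => Finset.le_sup (f := f) (S.equivFin.symm j).2
    · refine Finset.sup_le fun i hi => ?_
      have := Finset.le_sup (f := fun j => f (S.equivFin.symm j))
        (Finset.mem_univ (S.equivFin ⟨i, hi⟩))
      simpa using this
  refine ⟨S.card, fun j => x (S.equivFin.symm j), fun j => c (S.equivFin.symm j), ?_, fun φ => ?_⟩
  · rw [key c, hc]
  · rw [hμ, ← key]

theorem isDotMeasure_finset_sup {ι : Type*} (S : Finset ι) (x : ι → X) (c : ι → I)
    (hc : S.sup c = 1) : IsDotMeasure fun φ : C(X, I) => S.sup fun i => c i * φ (x i) := by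
  refine ⟨by simpa using hc, fun a φ => ?_, fun φ ψ => ?_⟩
  · have := Finset.apply_sup_eq_sup_comp (s := S) (f := fun i => c i * φ (x i)) (fun b : I => a * b)
      (unitInterval.mul_sup a) (mul_zero a)
    rw [this]
    exact Finset.sup_congr rfl fun i _ => mul_left_comm _ _ _
  · rw [← Finset.sup_sup]
    exact Finset.sup_congr rfl fun i _ => unitInterval.mul_sup _ _ _

end

/-! ### Approximation by finite measures with the same barycenter -/

section

variable {T : Type*} {K : Set (T → I)}

/-- Coordinate slabs form a neighbourhood basis. -/
theorem exists_slab_subset (x : K) {N : Set K} (hN : N ∈ 𝓝 x) :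
    ∃ (F : Set T) (ε : T → ℝ), F.Finite ∧ (∀ t, 0 < ε t) ∧
      {z : K | ∀ t ∈ F, |(z.1 t : ℝ) - x.1 t| ≤ ε t} ⊆ N ∧
      {z : K | ∀ t ∈ F, |(z.1 t : ℝ) - x.1 t| ≤ ε t} ∈ 𝓝 x := by
  obtain ⟨V, hV, hVN⟩ := mem_nhds_subtype K x N |>.1 hN
  rw [nhds_pi] at hV
  obtain ⟨F, hF, u, hu, hFV⟩ := Filter.mem_pi.1 hV
  choose ε hε hball using fun t => Metric.nhds_basis_closedBall.mem_iff.1 (hu t)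
  refine ⟨F, ε, hF, hε, fun z hz => hVN (hFV fun t ht => hball t ?_), ?_⟩
  · rw [Metric.mem_closedBall, Subtype.dist_eq, Real.dist_eq]
    exact hz t ht
  · change ∀ᶠ z : K in 𝓝 x, ∀ t ∈ F, |(z.1 t : ℝ) - x.1 t| ≤ ε t
    rw [Filter.eventually_all_finite hF]
    intro t _
    have hc : Continuous fun z : K => |(z.1 t : ℝ) - x.1 t| :=
      ((continuous_subtype_val.comp (coordMap K t).continuous).sub continuous_const).abs
    filter_upwards [hc.continuousAt.eventually_lt continuousAt_const
      (by simpa using hε t)] with z hz using hz.le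

variable (hK : IsCompact K) (hconv : IsMaxDotConvex K)

/-- Every `·`-measure can be approximated by finite ones with the same barycenter. -/
theorem exists_finDotMeasure_same_barycenter (μ : dotMeasures K) {U : Set (dotMeasures K)}
    (hU : U ∈ 𝓝 μ) :
    ∃ ν ∈ finDotMeasures K, ν ∈ U ∧ dotBarycenter K hK hconv ν = dotBarycenter K hK hconv μ := by
  have : CompactSpace K := isCompact_iff_compactSpace.1 hK
  obtain ⟨V, hV, hVU⟩ := mem_nhds_subtype _ μ U |>.1 hU
  rw [nhds_pi] at hV
  obtain ⟨F, hF, u, hu, hFV⟩ := Filter.mem_pi.1 hV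
  choose δ hδ hball using fun φ => Metric.nhds_basis_closedBall.mem_iff.1 (hu φ)
  have loc : ∀ x : K, ∃ f : C(K, I), {z | f z = 1} ∈ 𝓝 x ∧ ∃ b : K,
      (∀ t, μ.1 f * b.1 t = μ.1 (f * coordMap K t)) ∧
      ∀ φ ∈ F, |(μ.1 (f * φ) : ℝ) - μ.1 f * φ b| ≤ δ φ := by
    intro x
    -- Half of `δ φ`, since `φ z` and `φ b` are later compared through `φ x`.
    have hN : {z : K | ∀ φ ∈ F, |(φ z : ℝ) - φ x| < δ φ / 2} ∈ 𝓝 x := by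
      change ∀ᶠ z : K in 𝓝 x, ∀ φ ∈ F, |(φ z : ℝ) - φ x| < δ φ / 2
      rw [Filter.eventually_all_finite hF]
      intro φ _
      have hc : Continuous fun z : K => |(φ z : ℝ) - φ x| :=
        ((continuous_subtype_val.comp φ.continuous).sub continuous_const).abs
      exact hc.continuousAt.eventually_lt continuousAt_const (by simpa using half_pos (hδ φ))
    obtain ⟨G, ε, hG, hε, hsub, hnhds⟩ := exists_slab_subset x hN
    obtain ⟨g, f, hgf, hg, hf⟩ := exists_sup_eq_one hnhds
    have hfB : ∀ z, f z ≠ 0 → ∀ t ∈ G, |(z.1 t : ℝ) - x.1 t| ≤ ε t := fun z hz => by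
      by_contra hc
      exact hz (hf z hc)
    obtain ⟨b, hb, hb'⟩ := μ.2.exists_restrict_barycenter hK hconv f x
    have hbN := hsub (show b ∈ {z : K | ∀ t ∈ G, |(z.1 t : ℝ) - x.1 t| ≤ ε t} from
      fun t ht => hb' t _ _ (fun z hz => hfB z hz t ht) (by simpa using (hε t).le))
    refine ⟨f, ?_, b, hb, fun φ hφ => ?_⟩
    -- Where `g < 1`, the identity `g ⊔ f = 1` forces `f = 1`; this happens near `x` because `g x =
    -- 0`.
    · have : ∀ᶠ z in 𝓝 x, g z < 1 :=
        g.continuous.continuousAt.eventually_lt continuousAt_const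
          (by rw [hg]; exact zero_lt_one)
      filter_upwards [this] with z hz
      have h1 : g z ⊔ f z = 1 := DFunLike.congr_fun hgf z
      rcases le_total (g z) (f z) with h | h
      · rwa [sup_eq_right.2 h] at h1
      · rw [sup_eq_left.2 h] at h1
        exact absurd h1 hz.ne
    · refine (μ.2.abs_map_mul_sub_le f φ (φ b) (δ φ) (fun z hz => ?_) (hδ φ).le).trans
        (mul_le_of_le_one_left (hδ φ).le (μ.1 f).2.2)
      have h1 := hsub (hfB z hz) φ hφ
      have h2 := hbN φ hφ
      rw [abs_lt] at h1 h2
      rw [abs_le]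
      constructor <;> linarith
  choose f hf b hb hφ using loc
  obtain ⟨S, hS⟩ := CompactSpace.elim_nhds_subcover _ hf
  have cover : ∀ z : K, ∃ x ∈ S, f x z = 1 := fun z => by
    have : z ∈ ⋃ x ∈ S, {z | f x z = 1} := hS ▸ mem_univ z
    simpa using this
  -- The maximum of the `f x` over `S` is `1`, so `φ` is the maximum of the products `f x * φ`.
  have decomp : ∀ φ : C(K, I), μ.1 φ = S.sup fun x => μ.1 (f x * φ) := by
    intro φ
    obtain ⟨g, hg, hg'⟩ := μ.2.exists_finset_sup S fun x => f x * φ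
    rw [← hg']
    refine congrArg μ.1 (ContinuousMap.ext fun z => le_antisymm ?_ ?_)
    · obtain ⟨x, hx, hx1⟩ := cover z
      rw [hg]
      have := Finset.le_sup (f := fun x => (f x * φ) z) hx
      simpa [hx1] using this
    · rw [hg]
      exact Finset.sup_le fun x _ => mul_le_of_le_one_left' le_one'
  have hone : (S.sup fun x => μ.1 (f x)) = 1 := by
    rw [← μ.2.map_one, decomp]
    exact Finset.sup_congr rfl fun x _ => congrArg μ.1 (mul_one (f x)).symm
  refine ⟨⟨_, isDotMeasure_finset_sup S b _ hone⟩,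
    mem_finDotMeasures_of_finset S b _ hone _ fun _ => rfl, hVU (hFV fun φ hφF => hball φ ?_), ?_⟩
  · rw [Metric.mem_closedBall, Subtype.dist_eq, Real.dist_eq, decomp φ, abs_sub_le_iff,
      sub_le_iff_le_add', sub_le_iff_le_add']
    have key := fun x => abs_le.1 (hφ x φ hφF)
    constructor <;>
      refine unitInterval.finset_sup_le_add S _ _ (hδ φ).le fun x _ => ?_
    · change (μ.1 (f x) : ℝ) * φ (b x) ≤ _
      linarith [(key x).1]
    · change _ ≤ (μ.1 (f x) : ℝ) * φ (b x) + _
      linarith [(key x).2]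
  · apply Subtype.ext
    funext t
    change (S.sup fun x => μ.1 (f x) * (b x).1 t) = μ.1 (coordMap K t)
    rw [decomp]
    exact Finset.sup_congr rfl fun x _ => hb x t

/-- The approximating finite measure can be chosen inside the open set `U` without moving the
barycenter, so no image point is lost. -/
theorem image_dotBarycenter_finDotMeasures {U : Set (dotMeasures K)} (hU : IsOpen U) :
    (fun μ : finDotMeasures K => dotBarycenter K hK hconv μ.1) '' (Subtype.val ⁻¹' U) =
      dotBarycenter K hK hconv '' U := by
  ext z
  constructor
  · rintro ⟨μ, hμ, rfl⟩
    exact ⟨μ.1, hμ, rfl⟩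
  · rintro ⟨μ, hμ, rfl⟩
    obtain ⟨ν, hν, hνU, he⟩ := exists_finDotMeasure_same_barycenter hK hconv μ (hU.mem_nhds hμ)
    exact ⟨⟨ν, hν⟩, hνU, he⟩

theorem isOpenMap_finite_iff :
    IsOpenMap (fun μ : finDotMeasures K => dotBarycenter K hK hconv μ.1) ↔
      IsOpenMap (dotBarycenter K hK hconv) := by
  constructor
  · intro h U hU
    rw [← image_dotBarycenter_finDotMeasures hK hconv hU]
    exact h _ (hU.preimage continuous_subtype_val)
  · rintro h _ ⟨U, hU, rfl⟩
    rw [image_dotBarycenter_finDotMeasures hK hconv hU]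
    exact h U hU

/-! ### From open convex combination to open barycenter map -/

/-- If convex combination is open, then local openness of the barycenter map persists under
convex combinations with Dirac measures. -/
theorem nhds_le_map_dotBarycenter_comb (hs : IsOpenMap (dotComb K hconv)) {μ : dotMeasures K}
    (hμ : 𝓝 (dotBarycenter K hK hconv μ) ≤ Filter.map (dotBarycenter K hK hconv) (𝓝 μ))
    (y : K) (q : dotJ) :
    𝓝 (dotBarycenter K hK hconv (dotMeasureComb μ (dotDirac y) q)) ≤
      Filter.map (dotBarycenter K hK hconv) (𝓝 (dotMeasureComb μ (dotDirac y) q)) := by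
  calc 𝓝 (dotBarycenter K hK hconv (dotMeasureComb μ (dotDirac y) q))
      ≤ Filter.map (dotComb K hconv) (𝓝 (dotBarycenter K hK hconv μ, y, q)) :=
        hs.nhds_le _
    _ ≤ Filter.map (dotComb K hconv)
          (Filter.map (Prod.map (dotBarycenter K hK hconv) id) (𝓝 (μ, y, q))) := by
        refine Filter.map_mono ?_
        rw [nhds_prod_eq, nhds_prod_eq (x := μ), ← Filter.prod_map_map_eq', Filter.map_id]
        exact Filter.prod_mono_left _ hμ
    _ = Filter.map (dotBarycenter K hK hconv)
          (Filter.map (fun w : dotMeasures K × K × dotJ =>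
            dotMeasureComb w.1 (dotDirac w.2.1) w.2.2) (𝓝 (μ, y, q))) := by
        -- The barycenter of `t·μ ∨ p·δ_y` is by definition `s` applied to the barycenter of `μ` and
        -- `y`.
        rw [Filter.map_map, Filter.map_map]
        rfl
    _ ≤ _ := Filter.map_mono (continuous_dotMeasureComb_dirac.tendsto (μ, y, q))

/-- A finite measure is built from one Dirac measure by adjoining the others one at a time, each
step preserving local openness. Any other measure borrows local openness from a nearby finite one
with the same barycenter. -/
theorem isOpenMap_dotBarycenter_of_dotComb (hs : IsOpenMap (dotComb K hconv)) :
    IsOpenMap (dotBarycenter K hK hconv) := by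
  classical
  have dirac : ∀ x : K, 𝓝 (dotBarycenter K hK hconv (dotDirac x)) ≤
      Filter.map (dotBarycenter K hK hconv) (𝓝 (dotDirac x)) := by
    intro x
    have hc : Continuous (dotDirac : K → dotMeasures K) :=
      Continuous.subtype_mk (continuous_pi fun φ => φ.continuous) _
    calc 𝓝 (dotBarycenter K hK hconv (dotDirac x))
        = Filter.map (dotBarycenter K hK hconv) (Filter.map dotDirac (𝓝 x)) :=
          (Filter.map_id (f := 𝓝 x)).symm
      _ ≤ _ := Filter.map_mono (hc.tendsto x)
  rw [isOpenMap_iff_nhds_le]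
  intro μ U hU
  -- Passing to the interior makes the preimage of `U` a neighbourhood of `ν` as well as of `μ`.
  obtain ⟨ν, ⟨n, x, c, hc, hν⟩, hνU, he⟩ :=
    exists_finDotMeasure_same_barycenter hK hconv μ (interior_mem_nhds.2 (Filter.mem_map.1 hU))
  have hn : (Finset.univ : Finset (Fin n)).Nonempty := by
    rw [Finset.nonempty_iff_ne_empty]
    intro h
    rw [h, Finset.sup_empty] at hc
    exact zero_ne_one hc
  obtain ⟨i₀, -, hi₀⟩ := Finset.exists_mem_eq_sup _ hn c
  rw [hc] at hi₀
  -- Starting from the point `x i₀` of coefficient `1`, every adjunction uses the pair `(1, c i)`,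
  -- which lies in `J`.
  have step : ∀ S : Finset (Fin n), ∃ κ : dotMeasures K,
      (∀ φ, κ.1 φ = φ (x i₀) ⊔ S.sup fun i => c i * φ (x i)) ∧
      𝓝 (dotBarycenter K hK hconv κ) ≤ Filter.map (dotBarycenter K hK hconv) (𝓝 κ) := by
    intro S
    induction S using Finset.induction_on with
    | empty => exact ⟨dotDirac (x i₀), fun φ => (sup_bot_eq _).symm, dirac _⟩
    | insert i S _ ih =>
      obtain ⟨κ, hκ, hκ'⟩ := ih
      refine ⟨dotMeasureComb κ (dotDirac (x i)) ⟨(1, c i), sup_eq_left.2 le_one'⟩, fun φ => ?_,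
        nhds_le_map_dotBarycenter_comb hK hconv hs hκ' _ _⟩
      change 1 * κ.1 φ ⊔ c i * φ (x i) = _
      rw [one_mul, hκ, Finset.sup_insert, sup_assoc, sup_comm (c i * φ (x i))]
  obtain ⟨κ, hκ, hκ'⟩ := step Finset.univ
  have hκν : κ = ν := by
    refine Subtype.ext (funext fun φ => ?_)
    rw [hκ, hν]
    refine sup_eq_right.2 ?_
    have := Finset.le_sup (f := fun i => c i * φ (x i)) (Finset.mem_univ i₀)
    simpa [← hi₀] using this
  rw [hκν, he] at hκ'
  exact hκ' (Filter.mem_map.2 (mem_interior_iff_mem_nhds.1 hνU))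

/-! ### From open barycenter map to open convex combination -/

/-- Local openness of convex combination at a point with first coefficient `1`. -/
theorem nhds_le_map_dotComb_of_fst_eq_one (hβ : IsOpenMap (dotBarycenter K hK hconv)) (x y : K)
    (q : dotJ) (hq : q.1.1 = 1) :
    𝓝 (dotComb K hconv (x, y, q)) ≤ Filter.map (dotComb K hconv) (𝓝 (x, y, q)) := by
  have : CompactSpace K := isCompact_iff_compactSpace.1 hK
  -- Equal points cannot be separated by functions, but then `z ↦ (z, z, q)` is a continuous section
  -- of `s`.
  by_cases hxy : x = y
  · subst hxy
    have hdiag : ∀ z : K, dotComb K hconv (z, z, q) = z := fun z => by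
      apply Subtype.ext
      funext t
      change q.1.1 * z.1 t ⊔ q.1.2 * z.1 t = z.1 t
      rw [hq, one_mul]
      exact sup_eq_left.2 (mul_le_of_le_one_left' le_one')
    have hc : Continuous fun z : K => (z, z, q) := by fun_prop
    calc 𝓝 (dotComb K hconv (x, x, q))
        = Filter.map (dotComb K hconv) (Filter.map (fun z : K => (z, z, q)) (𝓝 x)) := by
          rw [hdiag, Filter.map_map, show dotComb K hconv ∘ (fun z : K => (z, z, q)) = id from
            funext hdiag, Filter.map_id]
      _ ≤ _ := Filter.map_mono (hc.tendsto x)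
  intro A hA
  rw [Filter.mem_map, nhds_prod_eq, nhds_prod_eq] at hA
  obtain ⟨Nx, hNx, N', hN', hsub⟩ := Filter.mem_prod_iff.1 hA
  obtain ⟨Ny, hNy, Nq, hNq, hsub'⟩ := Filter.mem_prod_iff.1 hN'
  obtain ⟨F, ε, -, hε, hslab, hnhds⟩ := exists_slab_subset y hNy
  obtain ⟨f, g, hfg, hfy, hg⟩ := exists_sup_eq_one
    (Filter.inter_mem hnhds (isOpen_compl_singleton.mem_nhds (Ne.symm hxy)))
  have hpt : ∀ z, f z ⊔ g z = 1 := DFunLike.congr_fun hfg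
  have hgx : g x = 0 := hg x fun h => h.2 rfl
  have hfx : f x = 1 := by
    have := hpt x
    rwa [hgx, sup_eq_left.2 unitInterval.nonneg'] at this
  have hgy : g y = 1 := by
    have := hpt y
    rwa [hfy, sup_eq_right.2 unitInterval.nonneg'] at this
  choose u hu _ using fun μ : dotMeasures K => μ.2.exists_restrict_barycenter hK hconv f x
  -- The coefficient `q.1.2` may be `0`, so `v` need not be continuous at `μ₀`. It stays near `y`
  -- because `g` is supported in a slab around `y` and `y` is its default value.
  choose v hv hv' using fun μ : dotMeasures K => μ.2.exists_restrict_barycenter hK hconv g y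
  have hJ : ∀ μ : dotMeasures K, μ.1 f ⊔ μ.1 g = 1 := fun μ => by
    rw [← μ.2.map_sup, hfg, μ.2.map_one]
  set μ₀ := dotMeasureComb (dotDirac x) (dotDirac y) q with hμ₀
  have hval : ∀ φ, μ₀.1 φ = φ x ⊔ q.1.2 * φ y := fun φ => by
    change q.1.1 * φ x ⊔ q.1.2 * φ y = _
    rw [hq, one_mul]
  have hf₀ : μ₀.1 f = 1 := by
    rw [hval, hfx, hfy, mul_zero, sup_eq_left.2 unitInterval.nonneg']
  have hg₀ : μ₀.1 g = q.1.2 := by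
    rw [hval, hgx, hgy, mul_one, sup_eq_right.2 unitInterval.nonneg']
  have hvN : ∀ μ, v μ ∈ Ny := fun μ => hslab fun t ht => hv' μ t _ _ (fun z hz => by
    by_contra hc
    exact hz (hg z fun h => hc (h.1 t ht))) (by simpa using (hε t).le)
  have hqN : Filter.Tendsto (fun μ : dotMeasures K => (⟨(μ.1 f, μ.1 g), hJ μ⟩ : dotJ)) (𝓝 μ₀)
      (𝓝 q) := by
    have hc : Continuous fun μ : dotMeasures K => (⟨(μ.1 f, μ.1 g), hJ μ⟩ : dotJ) :=
      Continuous.subtype_mk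
        ((continuous_dotMeasure_apply f).prodMk (continuous_dotMeasure_apply g)) _
    have he : (⟨(μ₀.1 f, μ₀.1 g), hJ μ₀⟩ : dotJ) = q :=
      Subtype.ext (Prod.ext (hf₀.trans hq.symm) hg₀)
    simpa only [he] using hc.tendsto μ₀
  -- Here the limit of `μ f` is `1`, so the coordinates of `u μ` are eventually the quotients `μ (f
  -- * coordMap K t) / μ f`.
  have huN : Filter.Tendsto u (𝓝 μ₀) (𝓝 x) := by
    rw [tendsto_subtype_rng, tendsto_pi_nhds]
    intro t
    rw [tendsto_subtype_rng]
    have hcf : Filter.Tendsto (fun μ : dotMeasures K => (μ.1 f : ℝ)) (𝓝 μ₀) (𝓝 1) := by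
      have := (continuous_subtype_val.comp (continuous_dotMeasure_apply f)).tendsto μ₀
      simpa [hf₀, Function.comp_def] using this
    have hcc : Filter.Tendsto (fun μ : dotMeasures K => (μ.1 (f * coordMap K t) : ℝ)) (𝓝 μ₀)
        (𝓝 (x.1 t)) := by
      have h0 : μ₀.1 (f * coordMap K t) = x.1 t := by
        rw [hval]
        change f x * x.1 t ⊔ q.1.2 * (f y * y.1 t) = _
        rw [hfx, hfy, one_mul, zero_mul, mul_zero, sup_eq_left.2 unitInterval.nonneg']
      have := (continuous_subtype_val.comp
        (continuous_dotMeasure_apply (f * coordMap K t))).tendsto μ₀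
      simpa [h0, Function.comp_def] using this
    have hdiv := hcc.div hcf one_ne_zero
    rw [div_one] at hdiv
    refine hdiv.congr' ?_
    filter_upwards [hcf.eventually_ne one_ne_zero] with μ hμ
    change (μ.1 (f * coordMap K t) : ℝ) / μ.1 f = (u μ).1 t
    rw [div_eq_iff hμ, ← hu μ t, mul_comm]
    rfl
  refine hβ.nhds_le μ₀ (Filter.mem_map.2 ?_)
  filter_upwards [huN hNx, hqN hNq] with μ h1 h2
  have hmem := hsub (show (u μ, v μ, (⟨(μ.1 f, μ.1 g), hJ μ⟩ : dotJ)) ∈ Nx ×ˢ N' from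
    ⟨h1, hsub' ⟨hvN μ, h2⟩⟩)
  -- Each coordinate function is the maximum of its products with `f` and `g`, because `f ⊔ g = 1`.
  have he : dotBarycenter K hK hconv μ =
      dotComb K hconv (u μ, v μ, (⟨(μ.1 f, μ.1 g), hJ μ⟩ : dotJ)) := by
    apply Subtype.ext
    funext t
    change μ.1 (coordMap K t) = μ.1 f * (u μ).1 t ⊔ μ.1 g * (v μ).1 t
    rw [hu, hv, ← μ.2.map_sup]
    refine congrArg μ.1 (ContinuousMap.ext fun z => ?_)
    change z.1 t = f z * z.1 t ⊔ g z * z.1 t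
    rw [mul_comm (f z), mul_comm (g z), ← unitInterval.mul_sup, hpt, mul_one]
  rw [mem_preimage, he]
  exact hmem

/-- One of the two coefficients is always `1`; exchanging the points together with the coefficients
makes it the first. -/
theorem isOpenMap_dotComb_of_dotBarycenter (hβ : IsOpenMap (dotBarycenter K hK hconv)) :
    IsOpenMap (dotComb K hconv) := by
  rw [isOpenMap_iff_nhds_le]
  rintro ⟨x, y, q⟩
  have hq : q.1.1 ⊔ q.1.2 = 1 := q.2
  rcases le_total q.1.2 q.1.1 with h | h
  · exact nhds_le_map_dotComb_of_fst_eq_one hK hconv hβ x y q (by rwa [sup_eq_left.2 h] at hq)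
  · let swap : dotJ → dotJ := fun r => ⟨(r.1.2, r.1.1), (sup_comm _ _).trans r.2⟩
    have hswap : Continuous swap := Continuous.subtype_mk
      ((continuous_snd.comp continuous_subtype_val).prodMk
        (continuous_fst.comp continuous_subtype_val)) _
    let flip : K × K × dotJ → K × K × dotJ := fun w => (w.2.1, w.1, swap w.2.2)
    have hflip : Continuous flip := (continuous_fst.comp continuous_snd).prodMk
      (continuous_fst.prodMk (hswap.comp (continuous_snd.comp continuous_snd)))
    have hsym : dotComb K hconv ∘ flip = dotComb K hconv :=
      funext fun w => Subtype.ext (funext fun t => sup_comm _ _)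
    calc 𝓝 (dotComb K hconv (x, y, q))
        = 𝓝 (dotComb K hconv (y, x, swap q)) := by rw [← congrFun hsym]; rfl
      _ ≤ Filter.map (dotComb K hconv) (𝓝 (y, x, swap q)) :=
        nhds_le_map_dotComb_of_fst_eq_one hK hconv hβ y x (swap q)
          (by rwa [sup_eq_right.2 h] at hq)
      _ = Filter.map (dotComb K hconv) (Filter.map flip (𝓝 (y, x, swap q))) := by
        rw [Filter.map_map, hsym]
      _ ≤ _ := Filter.map_mono (hflip.tendsto (y, x, swap q))

end

theorem theorem4p2 {T : Type*} (X : Set (T → unitInterval)) (hX : IsCompact X)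
    (hconv : IsMaxDotConvex X) :
    List.TFAE [
      IsOpenMap (fun μ : finDotMeasures X => dotBarycenter X hX hconv μ.1),
      IsOpenMap (dotBarycenter X hX hconv),
      IsOpenMap (dotComb X hconv)] := by
  tfae_have 1 ↔ 2 := isOpenMap_finite_iff hX hconv
  tfae_have 2 → 3 := isOpenMap_dotComb_of_dotBarycenter hX hconv
  tfae_have 3 → 2 := isOpenMap_dotBarycenter_of_dotComb hX hconv
  tfae_finish
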